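/- **Proposition.** Let $X$ be a finite-dimensional complex Hilbert space, and identify the Hilbert space $X^*\otimes X$ with the operators $X\to X$ under the Hilbert–Schmidt inner product $\langle a,b\rangle=\mathrm{Tr}(a^\dagger b)$. Let $\{\alpha_1,\ldots,\alpha_N\}$ be an orthonormal basis of $X^*\otimes X$, and let $\delta\colon X^*\otimes X\to (X^*\otimes X)\otimes(X^*\otimes X)$ be the classical structure in $\mathbf{fdHilb}$ that it induces, i.e. the linear map with $\delta(\alpha_i)=\alpha_i\otimes\alpha_i$. Its copyables are the nonzero $x$ with $\delta(x)=x\otimes x$. Identifying $(X^*\otimes X)\otimes(X^*\otimes X)$ with $(X\otimes X)^*\otimes(X\otimes X)$, i.e. with the operators on $X\otimes X$, suppose that $\delta$ is completely positive: it is of the form $(\mathrm{id}\otimes\varepsilon\otimes\mathrm{id})\circ(f_*\otimes f)$ for some finite-dimensional Hilbert space $Z$ and some linear $f\colon X\to Z\otimes(X\otimes X)$, where $f_*=(f^\dagger)^*$ and $\varepsilon$ is the evaluation pairing of $Z$ with $Z^*$. Then: (a) the set of copyables is closed under adjoints, $\{x^\dagger : x \text{ copyable}\}=\{x : x\text{ copyable}\}$,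 and $\{\alpha_1,\ldots,\alpha_N\}=\{\alpha_1^\dagger,\ldots,\alpha_N^\dagger\}$; (b) the copyables are closed under absolute values $|x|=(x^\dagger x)^{1/2}$, and $\{|\alpha_1|,\ldots,|\alpha_N|\}\subseteq\{0,\alpha_1,\ldots,\alpha_N\}$; (c) $\delta(\mathrm{id})\,\delta(ab)=\delta(a)\,\delta(b)$, as operators on $X\otimes X$, for all $a,b\colon X\to X$; (d) positive semidefinite copyables commute pairwise. -/

import Mathlib

open scoped TensorProduct InnerProductSpace

noncomputable section

namespace CPStructure

universe u

variable (X : Type u) [NormedAddCommGroup X] [InnerProductSpace ℂ X] [FiniteDimensional ℂ X]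

/-- The conjugate-linear isomorphism `X ≃ X*`, `x ↦ ⟪x, ·⟫`, for the algebraic dual of a
finite-dimensional complex Hilbert space. -/
def riesz : X ≃ₗ⋆[ℂ] Module.Dual ℂ X :=
  haveI : CompleteSpace X := FiniteDimensional.complete ℂ X
  (InnerProductSpace.toDual ℂ X).toLinearEquiv.trans
    (LinearMap.toContinuousLinearMap (𝕜 := ℂ) (E := X) (F' := ℂ)).symm

theorem riesz_apply (x y : X) : riesz X x y = ⟪x, y⟫_ℂ := rfl

/-- The inner product `⟪φ_x, φ_y⟫ = ⟪y, x⟫` of the dual Hilbert space, where `φ_x = ⟪x, ·⟫`. -/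
abbrev dualCore : InnerProductSpace.Core ℂ (Module.Dual ℂ X) where
  inner φ ψ := ⟪(riesz X).symm ψ, (riesz X).symm φ⟫_ℂ
  conj_inner_symm φ ψ := inner_conj_symm _ _
  re_inner_nonneg φ := inner_self_nonneg
  add_left φ ψ χ := by simp [map_add]
  smul_left φ ψ r := by simp [map_smulₛₗ]
  definite φ h := by simpa using h

/-- The dual `X*` is a Hilbert space; hence so is `X* ⊗ X`, with the inner product
`⟪φ ⊗ x, ψ ⊗ y⟫ = ⟪φ, ψ⟫ ⟪x, y⟫`. -/
instance instDualNormedAddCommGroup : NormedAddCommGroup (Module.Dual ℂ X) :=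
  (dualCore X).toNormedAddCommGroup

instance instDualInnerProductSpace : InnerProductSpace ℂ (Module.Dual ℂ X) :=
  .ofCore (dualCore X).toCore

/-- The object `X* ⊗ X` of fdHilb. -/
abbrev Name : Type u := Module.Dual ℂ X ⊗[ℂ] X

/-- The identification of `X* ⊗ X` with the operators on `X`: `φ ⊗ x` is `y ↦ φ y • x`. -/
def op : Name X ≃ₗ[ℂ] (X →ₗ[ℂ] X) := dualTensorHomEquiv ℂ X X

variable {X} in
theorem op_tmul (φ : Module.Dual ℂ X) (x y : X) : op X (φ ⊗ₜ[ℂ] x) y = φ y • x := rfl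

/-- Under this identification, the inner product of `X* ⊗ X` is the Hilbert-Schmidt inner
product `Tr (a† b)`. -/
theorem inner_eq_trace (a b : Name X) :
    ⟪a, b⟫_ℂ = LinearMap.trace ℂ X (LinearMap.adjoint (op X a) ∘ₗ op X b) := by
  induction a using TensorProduct.induction_on with
  | zero => simp
  | add a a' ha ha' => simp [inner_add_left, LinearMap.add_comp, ha, ha']
  | tmul φ x =>
    induction b using TensorProduct.induction_on with
    | zero => simp
    | add b b' hb hb' => simp [inner_add_right, LinearMap.comp_add, hb, hb']
    | tmul ψ y =>
      have h1 : LinearMap.adjoint (op X (φ ⊗ₜ x)) =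
          op X (riesz X x ⊗ₜ[ℂ] (riesz X).symm φ) := by
        symm
        rw [LinearMap.eq_adjoint_iff]
        intro u v
        have h2 : φ v = ⟪(riesz X).symm φ, v⟫_ℂ := by
          rw [← riesz_apply, LinearEquiv.apply_symm_apply]
        simp [op_tmul, h2, inner_smul_left, inner_smul_right, riesz_apply, mul_comm]
      have h3 : LinearMap.adjoint (op X (φ ⊗ₜ x)) ∘ₗ op X (ψ ⊗ₜ y) =
          op X (ψ ⊗ₜ[ℂ] (⟪x, y⟫_ℂ • (riesz X).symm φ)) := by
        rw [h1]
        ext v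
        simp [op_tmul, riesz_apply, smul_smul, mul_comm]
      have h4 : ψ ((riesz X).symm φ) = ⟪(riesz X).symm ψ, (riesz X).symm φ⟫_ℂ := by
        rw [← riesz_apply, LinearEquiv.apply_symm_apply]
      have h5 : ⟪φ, ψ⟫_ℂ = ⟪(riesz X).symm ψ, (riesz X).symm φ⟫_ℂ := rfl
      rw [h3, TensorProduct.inner_tmul, h5, ← h4]
      simp only [op, dualTensorHomEquiv, LinearEquiv.ofBijective_apply]
      rw [LinearMap.trace_eq_contract_apply, contractLeft_apply, map_smul, smul_eq_mul, mul_comm]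

variable {X}

/-- The adjoint `a†`, on `X* ⊗ X`. -/
def dagger (a : Name X) : Name X := (op X).symm (LinearMap.adjoint (op X a))

/-- The absolute value `|a| = (a† a)^(1/2)`, on `X* ⊗ X`. -/
def absVal (a : Name X) : Name X :=
  haveI : CompleteSpace X := FiniteDimensional.complete ℂ X
  (op X).symm (CFC.abs (LinearMap.toContinuousLinearMap (op X a))).toLinearMap

/-- The classical structure `δ : H → H ⊗ H` induced by an orthonormal basis of `H`, which copies
the basis vectors: `α_i ↦ α_i ⊗ α_i`. -/
def inducedStructure {H : Type*} [NormedAddCommGroup H] [InnerProductSpace ℂ H]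
    {ι : Type*} [Fintype ι] (α : OrthonormalBasis ι ℂ H) : H →ₗ[ℂ] H ⊗[ℂ] H :=
  α.toBasis.constr ℂ fun i => α i ⊗ₜ[ℂ] α i

/-- The (nonzero) copyables of `δ : H → H ⊗ H`. -/
def copyables {H : Type*} [AddCommGroup H] [Module ℂ H] (δ : H →ₗ[ℂ] H ⊗[ℂ] H) : Set H :=
  {x | δ x = x ⊗ₜ[ℂ] x} \ {0}

section CPM

variable {Y Z : Type u}
  [NormedAddCommGroup Y] [InnerProductSpace ℂ Y] [FiniteDimensional ℂ Y]
  [NormedAddCommGroup Z] [InnerProductSpace ℂ Z] [FiniteDimensional ℂ Z]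

/-- The conjugate `f_* = (f†)^* : X* → Y*`, `ξ ↦ ξ ∘ f†`, of a morphism `f : X → Y`. -/
def conj (f : X →ₗ[ℂ] Y) : Module.Dual ℂ X →ₗ[ℂ] Module.Dual ℂ Y :=
  (LinearMap.adjoint f).dualMap

/-- The morphism `(id ⊗ ε ⊗ id) ∘ (f_* ⊗ f) : X* ⊗ X → Y* ⊗ Y` with Kraus morphism
`f : X → Z ⊗ Y`, where `ε : Z* ⊗ Z → ℂ` is the evaluation. -/
def krausMap (f : X →ₗ[ℂ] Z ⊗[ℂ] Y) : Name X →ₗ[ℂ] Name Y :=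
  (TensorProduct.lid ℂ (Name Y)).toLinearMap ∘ₗ
    TensorProduct.map (contractLeft ℂ Z) LinearMap.id ∘ₗ
    (TensorProduct.tensorTensorTensorComm ℂ
      (Module.Dual ℂ Z) (Module.Dual ℂ Y) Z Y).toLinearMap ∘ₗ
    TensorProduct.map
      ((TensorProduct.dualDistribEquiv ℂ Z Y).symm.toLinearMap ∘ₗ conj f) f

/-- A linear map `X* ⊗ X → Y* ⊗ Y` is completely positive if it is a morphism of CPM(fdHilb),
i.e. if it has a Kraus morphism `f : X → Z ⊗ Y` for some finite-dimensional Hilbert space `Z`. -/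
def IsCP (F : Name X →ₗ[ℂ] Name Y) : Prop :=
  ∃ (Z : Type u) (_ : NormedAddCommGroup Z) (_ : InnerProductSpace ℂ Z)
    (_ : FiniteDimensional ℂ Z) (f : X →ₗ[ℂ] Z ⊗[ℂ] Y), F = krausMap f

end CPM

variable (X) in
/-- The canonical isomorphism `(X* ⊗ X) ⊗ (X* ⊗ X) ≅ (X ⊗ X)* ⊗ (X ⊗ X)`. -/
def merge : Name X ⊗[ℂ] Name X →ₗ[ℂ] Name (X ⊗[ℂ] X) :=
  TensorProduct.map (TensorProduct.dualDistrib ℂ X X) LinearMap.id ∘ₗ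
    (TensorProduct.tensorTensorTensorComm ℂ
      (Module.Dual ℂ X) X (Module.Dual ℂ X) X).toLinearMap

/-- The map from operators on `X` to operators on `X ⊗ X` that corresponds to
`δ : X* ⊗ X → (X* ⊗ X) ⊗ (X* ⊗ X)`. -/
def onOperators (δ : Name X →ₗ[ℂ] Name X ⊗[ℂ] Name X) :
    (X →ₗ[ℂ] X) →ₗ[ℂ] (X ⊗[ℂ] X →ₗ[ℂ] X ⊗[ℂ] X) :=
  (op (X ⊗[ℂ] X)).toLinearMap ∘ₗ merge X ∘ₗ δ ∘ₗ (op X).symm.toLinearMap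

end CPStructure

end

open scoped TensorProduct InnerProductSpace

namespace CPStructure

universe u

/-! Regard δ as a map D from operators on X to operators on X ⊗ X, with Kraus form D a = ∑ f_k a
f_k†. Then D respects adjoints and positivity, so copyables are closed under †; they are exactly the
α_i (`copyables_inducedStructure`), so † permutes the basis. Hence Tr(α_i α_j) = ⟪α_i†, α_j⟫ is 0 or
1. It therefore equals its square Tr(D α_i D α_j), and by bilinearity Tr(D a D b) = Tr(ab)
(`trace_onOperators_comp`). On rank-one operators this forces each f_k† f_l to preserve
orthogonality, hence to be a scalar, so D a D b depends only on ab: this is (c)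
(`map_id_comp_map_comp`). For (b), (c) shows that D|x| and |x| ⊗ |x| are positive with the same
square. For (d), distinct positive copyables are orthogonal, so their product has trace 0 and
vanishes. -/

theorem sum_comp_sum {V κ : Type*} [AddCommGroup V] [Module ℂ V] [Fintype κ]
    (A B : κ → V →ₗ[ℂ] V) :
    (∑ k, A k) ∘ₗ (∑ l, B l) = ∑ k, ∑ l, A k ∘ₗ B l :=
  Finset.sum_mul_sum (R := Module.End ℂ V) _ _ A B

/-! ### Rank-one operators, positivity and square roots -/

section Operators

variable {X Y : Type*}
  [NormedAddCommGroup X] [InnerProductSpace ℂ X] [FiniteDimensional ℂ X]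
  [NormedAddCommGroup Y] [InnerProductSpace ℂ Y] [FiniteDimensional ℂ Y]

/-- The rank-one operator `v ↦ ⟪y, v⟫ x`. -/
noncomputable def ketBra (x : X) (y : X) : X →ₗ[ℂ] X := (riesz X y).smulRight x

theorem ketBra_apply (x y v : X) : ketBra x y v = ⟪y, v⟫_ℂ • x := rfl

theorem trace_ketBra_comp (a b c d : X) :
    LinearMap.trace ℂ X (ketBra a b ∘ₗ ketBra c d) = ⟪b, c⟫_ℂ * ⟪d, a⟫_ℂ := by
  have h : ketBra a b ∘ₗ ketBra c d = ⟪b, c⟫_ℂ • ketBra a d := by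
    ext v
    simp [ketBra_apply, smul_smul, mul_comm]
  rw [h, map_smul, ketBra, LinearMap.trace_smulRight, riesz_apply, smul_eq_mul]

theorem comp_ketBra_comp_adjoint (f : X →ₗ[ℂ] Y) (x y : X) :
    f ∘ₗ ketBra x y ∘ₗ LinearMap.adjoint f = ketBra (f x) (f y) := by
  ext v
  simp [ketBra_apply, LinearMap.adjoint_inner_right]

theorem eq_zero_of_trace_adjoint_comp_self {A : X →ₗ[ℂ] X}
    (h : LinearMap.trace ℂ X (LinearMap.adjoint A ∘ₗ A) = 0) : A = 0 := by
  have := inner_eq_trace X ((op X).symm A) ((op X).symm A)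
  rw [LinearEquiv.apply_symm_apply, h] at this
  simpa using (inner_self_eq_zero (𝕜 := ℂ) (E := Name X)).1 this

theorem exists_selfAdjoint_sqrt {A : X →ₗ[ℂ] X} (hA : A.IsPositive) :
    ∃ S : X →ₗ[ℂ] X, LinearMap.adjoint S = S ∧ S ∘ₗ S = A := by
  have : CompleteSpace X := FiniteDimensional.complete ℂ X
  have hA' : 0 ≤ LinearMap.toContinuousLinearMap A := by
    rw [ContinuousLinearMap.nonneg_iff_isPositive]
    exact (LinearMap.isPositive_toContinuousLinearMap_iff A).2 hA
  refine ⟨(CFC.sqrt (LinearMap.toContinuousLinearMap A)).toLinearMap, ?_, ?_⟩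
  · have := CFC.sqrt_nonneg (LinearMap.toContinuousLinearMap A)
    rw [ContinuousLinearMap.nonneg_iff_isPositive] at this
    exact ((ContinuousLinearMap.isPositive_toLinearMap_iff _).2 this).adjoint_eq
  · have := CFC.sqrt_mul_sqrt_self _ hA'
    exact congrArg ContinuousLinearMap.toLinearMap this

theorem eq_of_comp_self_eq {A B : X →ₗ[ℂ] X} (hA : A.IsPositive) (hB : B.IsPositive)
    (h : A ∘ₗ A = B ∘ₗ B) : A = B := by
  have : CompleteSpace X := FiniteDimensional.complete ℂ X
  have pos {C : X →ₗ[ℂ] X} (hC : C.IsPositive) : 0 ≤ LinearMap.toContinuousLinearMap C := by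
    rw [ContinuousLinearMap.nonneg_iff_isPositive]
    exact (LinearMap.isPositive_toContinuousLinearMap_iff C).2 hC
  have h' : LinearMap.toContinuousLinearMap A * LinearMap.toContinuousLinearMap A =
      LinearMap.toContinuousLinearMap B * LinearMap.toContinuousLinearMap B := by
    ext v
    exact LinearMap.congr_fun h v
  apply LinearMap.toContinuousLinearMap.injective
  exact (CFC.sqrt_unique h' (pos hA)).symm.trans (CFC.sqrt_unique rfl (pos hB))

/-- With self-adjoint square roots S and T, Tr(AB) is the squared Hilbert–Schmidt norm of ST, so ST
= 0. -/
theorem comp_eq_zero_of_trace_eq_zero {A B : X →ₗ[ℂ] X} (hA : A.IsPositive) (hB : B.IsPositive)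
    (h : LinearMap.trace ℂ X (A ∘ₗ B) = 0) : A ∘ₗ B = 0 := by
  obtain ⟨S, hS, rfl⟩ := exists_selfAdjoint_sqrt hA
  obtain ⟨T, hT, rfl⟩ := exists_selfAdjoint_sqrt hB
  have hST : S ∘ₗ T = 0 := by
    apply eq_zero_of_trace_adjoint_comp_self
    rw [LinearMap.adjoint_comp, hS, hT, ← h, LinearMap.comp_assoc, LinearMap.trace_comp_comm']
    simp only [LinearMap.comp_assoc]
  calc (S ∘ₗ S) ∘ₗ T ∘ₗ T = S ∘ₗ (S ∘ₗ T) ∘ₗ T := by simp only [LinearMap.comp_assoc]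
    _ = 0 := by rw [hST, LinearMap.zero_comp, LinearMap.comp_zero]

theorem isPositive_map {A : X →ₗ[ℂ] X} {B : Y →ₗ[ℂ] Y} (hA : A.IsPositive)
    (hB : B.IsPositive) : (TensorProduct.map A B).IsPositive := by
  obtain ⟨S, hS, rfl⟩ := exists_selfAdjoint_sqrt hA
  obtain ⟨T, hT, rfl⟩ := exists_selfAdjoint_sqrt hB
  have h : LinearMap.adjoint (TensorProduct.map S T) = TensorProduct.map S T := by
    rw [TensorProduct.adjoint_map, hS, hT]
  rw [TensorProduct.map_comp]
  nth_rw 1 [← h]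
  exact LinearMap.isPositive_adjoint_comp_self _

/-- An operator that preserves all orthogonality relations is a scalar. -/
theorem exists_eq_smul_id_of_forall_inner_eq_zero {T : X →ₗ[ℂ] X}
    (h : ∀ x y : X, ⟪x, y⟫_ℂ = 0 → ⟪x, T y⟫_ℂ = 0) : ∃ c : ℂ, T = c • LinearMap.id := by
  refine LinearMap.exists_eq_smul_id_of_forall_notLinearIndependent fun y hy => ?_
  -- Everything orthogonal to y is orthogonal to T y, so T y lies on the line through y.
  have hT : T y ∈ (ℂ ∙ y)ᗮᗮ := by
    rw [Submodule.mem_orthogonal]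
    exact fun x hx => h x y (Submodule.mem_orthogonal_singleton_iff_inner_left.1 hx)
  rw [Submodule.orthogonal_orthogonal] at hT
  obtain ⟨c, hc⟩ := Submodule.mem_span_singleton.1 hT
  have hy0 : y ≠ 0 := hy.ne_zero 0
  exact (LinearIndependent.pair_iff' hy0).1 hy c hc

variable (X) in
theorem op_merge_tmul (a b : Name X) :
    op (X ⊗[ℂ] X) (merge X (a ⊗ₜ b)) = TensorProduct.map (op X a) (op X b) := by
  induction a using TensorProduct.induction_on with
  | zero => simp
  | add a a' ha ha' => simp [TensorProduct.add_tmul, TensorProduct.map_add_left, ha, ha']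
  | tmul φ x =>
    induction b using TensorProduct.induction_on with
    | zero => simp
    | add b b' hb hb' => simp [TensorProduct.tmul_add, TensorProduct.map_add_right, hb, hb']
    | tmul ψ y =>
      ext u v
      simp [merge, op_tmul, TensorProduct.tmul_smul, ← TensorProduct.smul_tmul', smul_smul, mul_comm]

end Operators

/-! ### From a Kraus morphism to Kraus operators -/

section Kraus

variable {X Y Z : Type u}
  [NormedAddCommGroup X] [InnerProductSpace ℂ X] [FiniteDimensional ℂ X]
  [NormedAddCommGroup Y] [InnerProductSpace ℂ Y] [FiniteDimensional ℂ Y]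
  [NormedAddCommGroup Z] [InnerProductSpace ℂ Z] [FiniteDimensional ℂ Z]

/-- The Kraus operator `(⟪z, ·⟫ ⊗ id) ∘ f`. -/
noncomputable def slice (f : X →ₗ[ℂ] Z ⊗[ℂ] Y) (z : Z) : X →ₗ[ℂ] Y :=
  (TensorProduct.lid ℂ Y).toLinearMap ∘ₗ TensorProduct.map (riesz Z z) LinearMap.id ∘ₗ f

theorem adjoint_slice_apply (f : X →ₗ[ℂ] Z ⊗[ℂ] Y) (z : Z) (y : Y) :
    LinearMap.adjoint (slice f z) y = LinearMap.adjoint f (z ⊗ₜ y) := by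
  refine ext_inner_right ℂ fun x => ?_
  rw [LinearMap.adjoint_inner_left, LinearMap.adjoint_inner_left, slice]
  simp only [LinearMap.comp_apply]
  induction f x using TensorProduct.induction_on with
  | zero => simp
  | add s t hs ht => simpa [inner_add_right] using congrArg₂ (· + ·) hs ht
  | tmul w v => simp [riesz_apply, inner_smul_right]

theorem dualDistribEquiv_symm_conj {ι : Type*} [Fintype ι] (e : OrthonormalBasis ι ℂ Z)
    (f : X →ₗ[ℂ] Z ⊗[ℂ] Y) (φ : Module.Dual ℂ X) :
    (TensorProduct.dualDistribEquiv ℂ Z Y).symm (conj f φ) =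
      ∑ k, riesz Z (e k) ⊗ₜ[ℂ] (φ ∘ₗ LinearMap.adjoint (slice f (e k))) := by
  rw [LinearEquiv.symm_apply_eq]
  have hd (ζ : Module.Dual ℂ Z) (η : Module.Dual ℂ Y) :
      TensorProduct.dualDistribEquiv ℂ Z Y (ζ ⊗ₜ η) =
        TensorProduct.dualDistrib ℂ Z Y (ζ ⊗ₜ η) := rfl
  ext z y
  have hz : z ⊗ₜ[ℂ] y = ∑ k, ⟪e k, z⟫_ℂ • (e k ⊗ₜ[ℂ] y) := by
    conv_lhs => rw [← e.sum_repr' z, TensorProduct.sum_tmul]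
    simp [TensorProduct.smul_tmul']
  simp only [map_sum, hd]
  simp only [TensorProduct.AlgebraTensorModule.curry_apply, LinearMap.restrictScalars_self,
    TensorProduct.curry_apply, LinearMap.sum_apply, TensorProduct.dualDistrib_apply,
    LinearMap.comp_apply, adjoint_slice_apply, riesz_apply]
  rw [hz, map_sum]
  simp [conj]

theorem op_krausMap {ι : Type*} [Fintype ι] (e : OrthonormalBasis ι ℂ Z)
    (f : X →ₗ[ℂ] Z ⊗[ℂ] Y) (a : Name X) :
    op Y (krausMap f a) =
      ∑ k, slice f (e k) ∘ₗ op X a ∘ₗ LinearMap.adjoint (slice f (e k)) := by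
  induction a using TensorProduct.induction_on with
  | zero => simp
  | add a b ha hb =>
    simp [ha, hb, LinearMap.add_comp, LinearMap.comp_add, Finset.sum_add_distrib]
  | tmul φ x =>
    -- For ζ = ⟪e k, ·⟫ the contraction with ζ cuts the slice at e k out of t = f x.
    have key (ζ : Module.Dual ℂ Z) (η : Module.Dual ℂ Y) (t : Z ⊗[ℂ] Y) :
        TensorProduct.lid ℂ (Name Y) (TensorProduct.map (contractLeft ℂ Z) LinearMap.id
          (TensorProduct.tensorTensorTensorComm ℂ (Module.Dual ℂ Z) (Module.Dual ℂ Y) Z Y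
            ((ζ ⊗ₜ η) ⊗ₜ t))) =
        η ⊗ₜ (TensorProduct.lid ℂ Y (TensorProduct.map ζ LinearMap.id t)) := by
      induction t using TensorProduct.induction_on with
      | zero => simp
      | add s t hs ht => simp only [TensorProduct.tmul_add, map_add, hs, ht]
      | tmul z y => simp
    have h : krausMap f (φ ⊗ₜ x) =
        ∑ k, (φ ∘ₗ LinearMap.adjoint (slice f (e k))) ⊗ₜ[ℂ] slice f (e k) x := by
      simp only [krausMap, LinearMap.comp_apply, TensorProduct.map_tmul,
        LinearEquiv.coe_coe, dualDistribEquiv_symm_conj e, TensorProduct.sum_tmul, map_sum, key]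
      rfl
    rw [h, map_sum]
    refine Finset.sum_congr rfl fun k _ => ?_
    ext v
    simp [op_tmul]

/-- A completely positive map has a Kraus decomposition `a ↦ ∑ k, f k a (f k)†`. -/
theorem IsCP.exists_kraus {F : Name X →ₗ[ℂ] Name Y} (hF : IsCP F) :
    ∃ (n : ℕ) (f : Fin n → X →ₗ[ℂ] Y),
      ∀ a, op Y (F a) = ∑ k, f k ∘ₗ op X a ∘ₗ LinearMap.adjoint (f k) := by
  obtain ⟨Z, _, _, _, f, rfl⟩ := hF
  exact ⟨_, _, fun a => op_krausMap (stdOrthonormalBasis ℂ Z) f a⟩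

end Kraus

/-! ### Kraus maps that preserve traces of products -/

section OrderZero

variable {X Y : Type*} {κ : Type*} [Fintype κ]
  [NormedAddCommGroup X] [InnerProductSpace ℂ X] [FiniteDimensional ℂ X]
  [NormedAddCommGroup Y] [InnerProductSpace ℂ Y] [FiniteDimensional ℂ Y]
  {f : κ → X →ₗ[ℂ] Y} {D : (X →ₗ[ℂ] X) →ₗ[ℂ] (Y →ₗ[ℂ] Y)}

theorem adjoint_of_kraus (hD : ∀ a, D a = ∑ k, f k ∘ₗ a ∘ₗ LinearMap.adjoint (f k))
    (a : X →ₗ[ℂ] X) : D (LinearMap.adjoint a) = LinearMap.adjoint (D a) := by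
  simp [hD, map_sum, LinearMap.adjoint_comp, LinearMap.adjoint_adjoint, LinearMap.comp_assoc]

theorem isPositive_of_kraus (hD : ∀ a, D a = ∑ k, f k ∘ₗ a ∘ₗ LinearMap.adjoint (f k))
    {a : X →ₗ[ℂ] X} (ha : a.IsPositive) : (D a).IsPositive := by
  rw [hD]
  exact LinearMap.isPositive_sum _ fun k _ => ha.conj_adjoint (f k)

/-- A completely positive map that preserves traces of products preserves products up to the
image of the identity. -/
theorem map_id_comp_map_comp (hD : ∀ a, D a = ∑ k, f k ∘ₗ a ∘ₗ LinearMap.adjoint (f k))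
    (htr : ∀ a b, LinearMap.trace ℂ Y (D a ∘ₗ D b) = LinearMap.trace ℂ X (a ∘ₗ b))
    (a b : X →ₗ[ℂ] X) : D LinearMap.id ∘ₗ D (a ∘ₗ b) = D a ∘ₗ D b := by
  -- Testing on |x⟩⟨x| and |y⟩⟨y| gives ∑ |⟪f k x, f l y⟫|² = |⟪x, y⟫|² = 0, so every term vanishes.
  have horth (x y : X) (hxy : ⟪x, y⟫_ℂ = 0) (k l : κ) : ⟪f k x, f l y⟫_ℂ = 0 := by
    have h := htr (ketBra x x) (ketBra y y)
    simp only [hD, comp_ketBra_comp_adjoint, sum_comp_sum, map_sum,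
      trace_ketBra_comp, hxy, zero_mul] at h
    simp only [← inner_conj_symm (f _ y) (f _ x), Complex.mul_conj] at h
    norm_cast at h
    rw [Finset.sum_eq_zero_iff_of_nonneg
      fun _ _ => Finset.sum_nonneg fun _ _ => Complex.normSq_nonneg _] at h
    have h' := h k (Finset.mem_univ k)
    rw [Finset.sum_eq_zero_iff_of_nonneg fun _ _ => Complex.normSq_nonneg _] at h'
    exact Complex.normSq_eq_zero.1 (h' l (Finset.mem_univ l))
  have hc (k l : κ) : ∃ c : ℂ, LinearMap.adjoint (f k) ∘ₗ f l = c • LinearMap.id :=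
    exists_eq_smul_id_of_forall_inner_eq_zero fun x y hxy => by
      rw [LinearMap.comp_apply, LinearMap.adjoint_inner_right]
      exact horth x y hxy k l
  choose c hc using hc
  -- The inner factor f_l† f_k is a scalar, so u and v become adjacent.
  have hprod (u v : X →ₗ[ℂ] X) : D u ∘ₗ D v =
      ∑ l, ∑ k, c l k • (f l ∘ₗ (u ∘ₗ v) ∘ₗ LinearMap.adjoint (f k)) := by
    simp only [hD, sum_comp_sum]
    refine Finset.sum_congr rfl fun l _ => Finset.sum_congr rfl fun k _ => ?_
    ext w
    have := LinearMap.congr_fun (hc l k) (v (LinearMap.adjoint (f k) w))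
    simp only [LinearMap.comp_apply, LinearMap.smul_apply, LinearMap.id_apply] at this ⊢
    simp [this]
  rw [hprod, hprod, LinearMap.id_comp]

end OrderZero

/-! ### Copyables of an induced structure -/

section Copyables

variable {H ι : Type*} [NormedAddCommGroup H] [InnerProductSpace ℂ H] [Fintype ι]
  (α : OrthonormalBasis ι ℂ H)

theorem inducedStructure_apply (i : ι) : inducedStructure α (α i) = α i ⊗ₜ[ℂ] α i := by
  have := α.toBasis.constr_basis ℂ (fun i => α i ⊗ₜ[ℂ] α i) i
  rwa [α.coe_toBasis] at this

/-- The copyables of the structure induced by an orthonormal basis are the basis vectors. -/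
theorem copyables_inducedStructure : copyables (inducedStructure α) = Set.range α := by
  ext x
  constructor
  · rintro ⟨hx, hx0⟩
    have hx' : inducedStructure α x = x ⊗ₜ[ℂ] x := hx
    -- Apply ⟪α i, ·⟫ ⊗ φ to δ x = x ⊗ x. Where the coefficient of x at i is nonzero, it cancels and
    -- leaves φ (α i) = φ x for every φ.
    have key (φ : H →ₗ[ℂ] ℂ) (i : ι) :
        ∑ j, ⟪α j, x⟫_ℂ * (⟪α i, α j⟫_ℂ * φ (α j)) = ⟪α i, x⟫_ℂ * φ x := by
      have h := congrArg (fun t => TensorProduct.lid ℂ ℂ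
        (TensorProduct.map (innerₛₗ ℂ (α i)) φ t)) hx'
      beta_reduce at h
      conv_lhs at h => rw [← α.sum_repr' x]
      simpa [inducedStructure_apply] using h
    have key' (φ : H →ₗ[ℂ] ℂ) (i : ι) : ⟪α i, x⟫_ℂ * φ (α i) = ⟪α i, x⟫_ℂ * φ x := by
      classical
      rw [← key φ i, Finset.sum_eq_single i]
      · simp
      · intro j _ hj
        simp [α.inner_eq_ite, hj.symm]
      · simp
    obtain ⟨i, hi⟩ : ∃ i, ⟪α i, x⟫_ℂ ≠ 0 := by
      by_contra! h
      apply hx0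
      rw [Set.mem_singleton_iff, ← α.sum_repr' x]
      simp [h]
    refine ⟨i, ext_inner_left ℂ fun v => ?_⟩
    exact mul_left_cancel₀ hi (key' (innerₛₗ ℂ v) i)
  · rintro ⟨i, rfl⟩
    exact ⟨inducedStructure_apply α i, α.orthonormal.ne_zero i⟩

end Copyables

/-! ### Completely positive classical structures -/

section Main

variable {X ι : Type*} [NormedAddCommGroup X] [InnerProductSpace ℂ X] [FiniteDimensional ℂ X]

theorem injective_merge : Function.Injective (merge X) := by
  have h : (merge X : Name X ⊗[ℂ] Name X → _) =
      TensorProduct.congr (TensorProduct.dualDistribEquiv ℂ X X) (LinearEquiv.refl ℂ _) ∘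
        TensorProduct.tensorTensorTensorComm ℂ (Module.Dual ℂ X) X (Module.Dual ℂ X) X := rfl
  rw [h]
  exact (LinearEquiv.injective _).comp (LinearEquiv.injective _)

theorem apply_eq_tmul_iff (δ : Name X →ₗ[ℂ] Name X ⊗[ℂ] Name X) (x : Name X) :
    δ x = x ⊗ₜ x ↔ onOperators δ (op X x) = TensorProduct.map (op X x) (op X x) := by
  rw [← op_merge_tmul]
  simp [onOperators, (op (X ⊗[ℂ] X)).injective.eq_iff, injective_merge.eq_iff]

theorem exists_kraus_onOperators {δ : Name X →ₗ[ℂ] Name X ⊗[ℂ] Name X}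
    (h : IsCP (merge X ∘ₗ δ)) : ∃ (n : ℕ) (f : Fin n → X →ₗ[ℂ] X ⊗[ℂ] X),
      ∀ a, onOperators δ a = ∑ k, f k ∘ₗ a ∘ₗ LinearMap.adjoint (f k) := by
  obtain ⟨n, f, hf⟩ := h.exists_kraus
  refine ⟨n, f, fun a => ?_⟩
  simpa [onOperators] using hf ((op X).symm a)

theorem op_dagger (a : Name X) : op X (dagger a) = LinearMap.adjoint (op X a) := by
  simp [dagger]

theorem dagger_dagger (a : Name X) : dagger (dagger a) = a := by
  simp [dagger, LinearMap.adjoint_adjoint]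

theorem isPositive_op_absVal (a : Name X) : (op X (absVal a)).IsPositive := by
  have : CompleteSpace X := FiniteDimensional.complete ℂ X
  rw [absVal, LinearEquiv.apply_symm_apply, ContinuousLinearMap.isPositive_toLinearMap_iff,
    ← ContinuousLinearMap.nonneg_iff_isPositive]
  exact CFC.abs_nonneg _

theorem op_absVal_comp_self (a : Name X) :
    op X (absVal a) ∘ₗ op X (absVal a) = LinearMap.adjoint (op X a) ∘ₗ op X a := by
  have : CompleteSpace X := FiniteDimensional.complete ℂ X
  rw [absVal, LinearEquiv.apply_symm_apply]
  exact congrArg ContinuousLinearMap.toLinearMap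
    (CFC.abs_mul_abs (LinearMap.toContinuousLinearMap (op X a)))

variable {δ : Name X →ₗ[ℂ] Name X ⊗[ℂ] Name X}

theorem dagger_mem_copyables (hcp : IsCP (merge X ∘ₗ δ)) {x : Name X} (hx : x ∈ copyables δ) :
    dagger x ∈ copyables δ := by
  obtain ⟨n, f, hf⟩ := exists_kraus_onOperators hcp
  refine ⟨(apply_eq_tmul_iff δ _).2 ?_, fun h => hx.2 ?_⟩
  · rw [op_dagger, adjoint_of_kraus hf, (apply_eq_tmul_iff δ x).1 hx.1, TensorProduct.adjoint_map]
  · rw [Set.mem_singleton_iff] at h ⊢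
    rw [← dagger_dagger x, h]
    simp [dagger]

theorem image_dagger_copyables (hcp : IsCP (merge X ∘ₗ δ)) :
    dagger '' copyables δ = copyables δ := by
  apply Set.Subset.antisymm
  · rintro _ ⟨x, hx, rfl⟩
    exact dagger_mem_copyables hcp hx
  · exact fun x hx => ⟨dagger x, dagger_mem_copyables hcp hx, dagger_dagger x⟩

variable [Fintype ι] {α : OrthonormalBasis ι ℂ (Name X)}

theorem trace_onOperators_comp (hδ : δ = inducedStructure α) (hcp : IsCP (merge X ∘ₗ δ))
    (a b : X →ₗ[ℂ] X) :
    LinearMap.trace ℂ (X ⊗[ℂ] X) (onOperators δ a ∘ₗ onOperators δ b) =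
      LinearMap.trace ℂ X (a ∘ₗ b) := by
  classical
  have hα (i : ι) : α i ∈ copyables δ := by
    rw [hδ, copyables_inducedStructure]
    exact ⟨i, rfl⟩
  have hD (i : ι) : onOperators δ (op X (α i)) = TensorProduct.map (op X (α i)) (op X (α i)) :=
    (apply_eq_tmul_iff δ _).1 (hα i).1
  have htr (i j : ι) : LinearMap.trace ℂ X (op X (α i) ∘ₗ op X (α j)) = 0 ∨
      LinearMap.trace ℂ X (op X (α i) ∘ₗ op X (α j)) = 1 := by
    have hi := dagger_mem_copyables hcp (hα i)
    rw [hδ, copyables_inducedStructure] at hi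
    obtain ⟨k, hk⟩ := hi
    have h := inner_eq_trace X (dagger (α i)) (α j)
    rw [op_dagger, LinearMap.adjoint_adjoint, ← hk] at h
    rw [← h]
    have h' := α.inner_eq_ite k j
    split_ifs at h' with hkj
    · exact Or.inr h'
    · exact Or.inl h'
  let e : Module.Basis ι ℂ (X →ₗ[ℂ] X) := α.toBasis.map (op X)
  let B : (X →ₗ[ℂ] X) →ₗ[ℂ] (X →ₗ[ℂ] X) →ₗ[ℂ] ℂ :=
    (LinearMap.mul ℂ (Module.End ℂ X)).compr₂ (LinearMap.trace ℂ X)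
  let B' : (X →ₗ[ℂ] X) →ₗ[ℂ] (X →ₗ[ℂ] X) →ₗ[ℂ] ℂ :=
    ((LinearMap.mul ℂ (Module.End ℂ (X ⊗[ℂ] X))).compr₂ (LinearMap.trace ℂ (X ⊗[ℂ] X))).compl₁₂
      (onOperators δ) (onOperators δ)
  have h : B' = B := by
    refine e.ext fun i => e.ext fun j => ?_
    have he (i : ι) : e i = op X (α i) := by simp [e]
    change LinearMap.trace ℂ _ (onOperators δ (e i) ∘ₗ onOperators δ (e j)) =
      LinearMap.trace ℂ _ (e i ∘ₗ e j)
    rw [he, he, hD, hD, ← TensorProduct.map_comp, LinearMap.trace_tensorProduct']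
    -- The trace of the tensor square is t * t, and t * t = t for t = 0 or 1.
    rcases htr i j with h | h <;> simp [h]
  exact LinearMap.congr_fun (LinearMap.congr_fun h a) b

theorem absVal_mem_copyables (hδ : δ = inducedStructure α) (hcp : IsCP (merge X ∘ₗ δ))
    {x : Name X} (hx : x ∈ copyables δ) : absVal x ∈ copyables δ := by
  obtain ⟨n, f, hf⟩ := exists_kraus_onOperators hcp
  have hmul := map_id_comp_map_comp hf (trace_onOperators_comp hδ hcp)
  refine ⟨(apply_eq_tmul_iff δ _).2 ?_, fun h => hx.2 ?_⟩
  -- (D|x|)² = D(id) D(x†x) = D(x†) D(x) = x†x ⊗ x†x = (|x| ⊗ |x|)².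
  · apply eq_of_comp_self_eq (isPositive_of_kraus hf (isPositive_op_absVal x))
      (isPositive_map (isPositive_op_absVal x) (isPositive_op_absVal x))
    rw [← hmul, op_absVal_comp_self, ← TensorProduct.map_comp, op_absVal_comp_self, hmul,
      TensorProduct.map_comp, adjoint_of_kraus hf, (apply_eq_tmul_iff δ x).1 hx.1,
      TensorProduct.adjoint_map]
  · rw [Set.mem_singleton_iff] at h ⊢
    have h' := op_absVal_comp_self x
    rw [h, map_zero, LinearMap.zero_comp] at h'
    have h0 : op X x = 0 := eq_zero_of_trace_adjoint_comp_self (by rw [← h', map_zero])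
    simpa using h0

theorem comp_comm_of_mem_copyables (hδ : δ = inducedStructure α) {x y : Name X}
    (hx : x ∈ copyables δ) (hy : y ∈ copyables δ)
    (hxp : (op X x).IsPositive) (hyp : (op X y).IsPositive) :
    op X x ∘ₗ op X y = op X y ∘ₗ op X x := by
  by_cases hxy : x = y
  · rw [hxy]
  rw [hδ, copyables_inducedStructure] at hx hy
  obtain ⟨i, rfl⟩ := hx
  obtain ⟨j, rfl⟩ := hy
  have htr : LinearMap.trace ℂ X (op X (α i) ∘ₗ op X (α j)) = 0 := by
    have h := inner_eq_trace X (α i) (α j)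
    rw [hxp.adjoint_eq] at h
    rw [← h]
    exact α.orthonormal.2 fun hij => hxy (congrArg α hij)
  rw [comp_eq_zero_of_trace_eq_zero hxp hyp htr, comp_eq_zero_of_trace_eq_zero hyp hxp
    (by rw [LinearMap.trace_comp_comm', htr])]

end Main

end CPStructure

theorem mainTheorem6 {X : Type*} [NormedAddCommGroup X] [InnerProductSpace ℂ X]
    [FiniteDimensional ℂ X] {ι : Type*} [Fintype ι]
    (α : OrthonormalBasis ι ℂ (CPStructure.Name X))
    (δ : CPStructure.Name X →ₗ[ℂ] CPStructure.Name X ⊗[ℂ] CPStructure.Name X)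
    (hδ : δ = CPStructure.inducedStructure α)
    (hcp : CPStructure.IsCP (CPStructure.merge X ∘ₗ δ)) :
    -- (a) closure under adjoints
    (CPStructure.dagger '' CPStructure.copyables δ = CPStructure.copyables δ ∧
      Set.range (fun i => CPStructure.dagger (α i)) = Set.range α) ∧
    -- (b) closure under absolute values
    ((∀ x ∈ CPStructure.copyables δ, CPStructure.absVal x ∈ CPStructure.copyables δ) ∧
      Set.range (fun i => CPStructure.absVal (α i)) ⊆ insert 0 (Set.range α)) ∧
    -- (c) multiplicativity up to the image of the identity
    (∀ a b : X →ₗ[ℂ] X,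
      CPStructure.onOperators δ LinearMap.id ∘ₗ CPStructure.onOperators δ (a ∘ₗ b) =
        CPStructure.onOperators δ a ∘ₗ CPStructure.onOperators δ b) ∧
    -- (d) positive semidefinite copyables commute
    (∀ x ∈ CPStructure.copyables δ, ∀ y ∈ CPStructure.copyables δ,
      (CPStructure.op X x).IsPositive → (CPStructure.op X y).IsPositive →
      CPStructure.op X x ∘ₗ CPStructure.op X y = CPStructure.op X y ∘ₗ CPStructure.op X x) := by
  have hrange := CPStructure.copyables_inducedStructure α
  rw [← hδ] at hrange
  obtain ⟨n, f, hf⟩ := CPStructure.exists_kraus_onOperators hcp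
  refine ⟨⟨CPStructure.image_dagger_copyables hcp, ?_⟩,
    ⟨fun x hx => CPStructure.absVal_mem_copyables hδ hcp hx, ?_⟩,
    CPStructure.map_id_comp_map_comp hf (CPStructure.trace_onOperators_comp hδ hcp),
    fun x hx y hy hxp hyp => CPStructure.comp_comm_of_mem_copyables hδ hx hy hxp hyp⟩
  · have h := CPStructure.image_dagger_copyables hcp
    rw [hrange, ← Set.range_comp] at h
    exact h
  · rintro _ ⟨i, rfl⟩
    -- Copyables are nonzero, so |α i| is always a basis vector and never 0.
    right
    rw [← hrange]
    exact CPStructure.absVal_mem_copyables hδ hcp (hrange ▸ ⟨i, rfl⟩)
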